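/- **Theorem (Strong completeness of the distributive full Lambek calculus).** *Syntax.* Let $\mathscr{C}$ be one of the categories $\mathbf{DL}$ (distributive lattices), $\mathbf{BDL}$ (bounded distributive lattices), $\mathbf{BA}$ (Boolean algebras), and let $V$ be a set of variables. An $L_{\mathrm{RL}}$-algebra is an object $A$ of $\mathscr{C}$ with a constant $I$ and binary operations $\otimes$, $\backslash$, $/$ such that for all $a\in A$ and all non-empty finite $X\subseteq A$ (for $\mathbf{BDL}$ and $\mathbf{BA}$ also for $X=\emptyset$, with $\bigvee\emptyset=\bot$, $\bigwedge\emptyset=\top$) $$\textstyle(\bigvee X)\otimes a=\bigvee_{x\in X}(x\otimes a),\quad a\otimes\bigvee X=\bigvee_{x\in X}(a\otimes x),\quad a\backslash\bigwedge X=\bigwedge_{x\in X}(a\backslash x),$$ $$\textstyle(\bigvee X)\backslash a=\bigwedge_{x\in X}(x\backslash a),\quad (\bigwedge X)/a=\bigwedge_{x\in X}(x/a),\quad a/\bigvee X=\bigwedge_{x\in X}(a/x).$$ The frame conditions are - FC1: $a\otimes I=a$ and $I\otimes a=a$; - FC2: $I\le a\backslash a$ and $I\le a/a$; - FC3: $a\otimes(b/c)\le(a\otimes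 b)/c$; - FC4: $(c\backslash b)\otimes a\le c\backslash(b\otimes a)$; - FC5: $(a/b)\otimes b\le a$; - FC6: $b\otimes(b\backslash a)\le a$. The distributive full Lambek calculus $\mathcal{Q}$ over $V$ is the free $L_{\mathrm{RL}}$-algebra over $V$ modulo the fully invariant congruence generated by FC1–FC6. For $\Phi,\Psi\subseteq\mathcal{Q}$ write $\Phi\vdash\Psi$ if there are finite $\Phi_0\subseteq\Phi$, $\Psi_0\subseteq\Psi$ with $\bigwedge\Phi_0\le\bigvee\Psi_0$ in $\mathcal{Q}$, where $\Phi_0$ and $\Psi_0$ have to be non-empty if $\mathscr{C}=\mathbf{DL}$. *Semantics.* For a poset $X$ let $\mathsf{P}_c(X)$ be the set of convex subsets of $X$ with the Egli–Milner order: $U\le U'$ iff every $x\in U$ is below some $x'\in U'$ and every $x'\in U'$ is above some $x\in U$. Let $\mathbf{2}=\{0,1\}$ with $1\le 0$. For a poset $W$ put $$T_{\mathrm{RL}}W=\mathbf{2}\times\mathsf{P}_c(W\times W)\times\mathsf{P}_c(W^{\mathrm{op}}\times W)\times\mathsf{P}_c(W\times W^{\mathrm{op}}).$$ A $T_{\mathrm{RL}}$-coalgebra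 on $W$ is a monotone map $\gamma=(\gamma_I,\gamma_\otimes,\gamma_\backslash,\gamma_/):W\to T_{\mathrm{RL}}W$. It makes the upsets of $W$ an algebra, with $\wedge=\cap$, $\vee=\cup$ and $$I=\{w\mid\gamma_I(w)=0\},\qquad u\otimes v=\{w\mid\exists(x,y)\in\gamma_\otimes(w):\ x\in u,\ y\in v\},$$ $$u\backslash s=\{w\mid\forall(x,y)\in\gamma_\backslash(w):\ x\in u\Rightarrow y\in s\},\qquad s/v=\{w\mid\forall(x,y)\in\gamma_/(w):\ y\in v\Rightarrow x\in s\}.$$ If $\mathscr{C}$ is $\mathbf{BDL}$ or $\mathbf{BA}$, then $\top=W$ and $\bot=\emptyset$. If $\mathscr{C}=\mathbf{BA}$, only sets, that is, discrete posets $W$, are considered, and negation is the set complement. A valuation $v$ of the variables by upsets of $W$ extends to an interpretation $[\![a]\!]_{(\gamma,v)}$ of all formulas $a$. The coalgebra validates FC1–FC6 if these hold in the algebra of upsets of $W$, for all values of $a,b,c$. *Claim.* The distributive full Lambek calculus is strongly complete with respect to the class of $T_{\mathrm{RL}}$-coalgebras validating FC1–FC6: for all $\Phi,\Psi\subseteq\mathcal{Q}$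 with $\Phi\nvdash\Psi$ there are a poset $W$ (discrete if $\mathscr{C}=\mathbf{BA}$), a $T_{\mathrm{RL}}$-coalgebra $\gamma$ on $W$ that validates FC1–FC6, a valuation $v$ and a point $x\in W$ such that $x\in[\![a]\!]_{(\gamma,v)}$ for every formula $a$ whose class is in $\Phi$, and $x\notin[\![b]\!]_{(\gamma,v)}$ for every formula $b$ whose class is in $\Psi$. -/

import Mathlib

universe u w

namespace RL

/-- The three reasoning kernels: distributive lattices, bounded distributive lattices and
Boolean algebras. -/
inductive Kernel where
  | DL
  | BDL
  | BA

/-- The kernel has constants `⊤` and `⊥`. -/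
def Kernel.HasBounds : Kernel → Prop
  | .DL => False
  | .BDL => True
  | .BA => True

/-- The kernel has a complement. -/
def Kernel.HasCompl : Kernel → Prop
  | .DL => False
  | .BDL => False
  | .BA => True

/-! ### Syntax -/

/-- Terms over the variables `V`, built from the operations of the kernel `K`, the constant `I`,
the fusion `a ⊗ b` (`tens a b`) and its two residuals `a ⊸ b` (`lres a b`, that is `a \ b`)
and `a ⟜ b` (`rres a b`, that is `a / b`). -/
inductive Fml (K : Kernel) (V : Type w) : Type w where
  | var : V → Fml K V
  | inf : Fml K V → Fml K V → Fml K V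
  | sup : Fml K V → Fml K V → Fml K V
  | top : K.HasBounds → Fml K V
  | bot : K.HasBounds → Fml K V
  | compl : K.HasCompl → Fml K V → Fml K V
  | I : Fml K V
  | tens : Fml K V → Fml K V → Fml K V
  | lres : Fml K V → Fml K V → Fml K V
  | rres : Fml K V → Fml K V → Fml K V

namespace Fml

/-- Simultaneous substitution. -/
def subst {K : Kernel} {V : Type u} {V' : Type w} (σ : V → Fml K V') : Fml K V → Fml K V'
  | var p => σ p
  | inf a b => inf (a.subst σ) (b.subst σ)
  | sup a b => sup (a.subst σ) (b.subst σ)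
  | top h => top h
  | bot h => bot h
  | compl h a => compl h (a.subst σ)
  | I => I
  | tens a b => tens (a.subst σ) (b.subst σ)
  | lres a b => lres (a.subst σ) (b.subst σ)
  | rres a b => rres (a.subst σ) (b.subst σ)

end Fml

open Fml in
/-- The frame conditions, as inequations `s ≤ t` between terms in the three variables
`a = var 0`, `b = var 1`, `c = var 2`. An equation is given as two inequations. -/
inductive FrameCond (K : Kernel) : Fml K (Fin 3) → Fml K (Fin 3) → Prop where
  | fc1a : FrameCond K (tens (var 0) I) (var 0)
  | fc1b : FrameCond K (var 0) (tens (var 0) I)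
  | fc1c : FrameCond K (tens I (var 0)) (var 0)
  | fc1d : FrameCond K (var 0) (tens I (var 0))
  | fc2a : FrameCond K I (lres (var 0) (var 0))
  | fc2b : FrameCond K I (rres (var 0) (var 0))
  | fc3 : FrameCond K (tens (var 0) (rres (var 1) (var 2))) (rres (tens (var 0) (var 1)) (var 2))
  | fc4 : FrameCond K (tens (lres (var 2) (var 1)) (var 0)) (lres (var 2) (tens (var 1) (var 0)))
  | fc5 : FrameCond K (tens (rres (var 0) (var 1)) (var 1)) (var 0)
  | fc6 : FrameCond K (tens (var 1) (lres (var 1) (var 0))) (var 0)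

open Fml in
/-- The fully invariant congruence on terms generated by the axioms of the kernel, the
distribution laws `DL1`-`DL6` and the frame conditions. The distribution laws are listed for
two-element joins and meets and, if the kernel has bounds, for empty ones. -/
inductive Eqv {K : Kernel} {V : Type w} : Fml K V → Fml K V → Prop where
  -- equivalence relation, compatible with all operations
  | refl (a) : Eqv a a
  | symm {a b} : Eqv a b → Eqv b a
  | trans {a b c} : Eqv a b → Eqv b c → Eqv a c
  | congr_inf {a a' b b'} : Eqv a a' → Eqv b b' → Eqv (inf a b) (inf a' b')
  | congr_sup {a a' b b'} : Eqv a a' → Eqv b b' → Eqv (sup a b) (sup a' b')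
  | congr_compl (h) {a a'} : Eqv a a' → Eqv (compl h a) (compl h a')
  | congr_tens {a a' b b'} : Eqv a a' → Eqv b b' → Eqv (tens a b) (tens a' b')
  | congr_lres {a a' b b'} : Eqv a a' → Eqv b b' → Eqv (lres a b) (lres a' b')
  | congr_rres {a a' b b'} : Eqv a a' → Eqv b b' → Eqv (rres a b) (rres a' b')
  -- distributive lattices
  | inf_comm (a b) : Eqv (inf a b) (inf b a)
  | sup_comm (a b) : Eqv (sup a b) (sup b a)
  | inf_assoc (a b c) : Eqv (inf (inf a b) c) (inf a (inf b c))
  | sup_assoc (a b c) : Eqv (sup (sup a b) c) (sup a (sup b c))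
  | inf_sup_self (a b) : Eqv (inf a (sup a b)) a
  | sup_inf_self (a b) : Eqv (sup a (inf a b)) a
  | inf_sup_left (a b c) : Eqv (inf a (sup b c)) (sup (inf a b) (inf a c))
  -- bounds and complements
  | inf_top (h) (a) : Eqv (inf a (top h)) a
  | sup_bot (h) (a) : Eqv (sup a (bot h)) a
  | inf_compl (h) (h') (a) : Eqv (inf a (compl h a)) (bot h')
  | sup_compl (h) (h') (a) : Eqv (sup a (compl h a)) (top h')
  -- distribution laws
  | dl1 (x y a) : Eqv (tens (sup x y) a) (sup (tens x a) (tens y a))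
  | dl2 (a x y) : Eqv (tens a (sup x y)) (sup (tens a x) (tens a y))
  | dl3 (a x y) : Eqv (lres a (inf x y)) (inf (lres a x) (lres a y))
  | dl4 (x y a) : Eqv (lres (sup x y) a) (inf (lres x a) (lres y a))
  | dl5 (x y a) : Eqv (rres (inf x y) a) (inf (rres x a) (rres y a))
  | dl6 (a x y) : Eqv (rres a (sup x y)) (inf (rres a x) (rres a y))
  | dl1_empty (h) (a) : Eqv (tens (bot h) a) (bot h)
  | dl2_empty (h) (a) : Eqv (tens a (bot h)) (bot h)
  | dl3_empty (h) (a) : Eqv (lres a (top h)) (top h)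
  | dl4_empty (h) (a) : Eqv (lres (bot h) a) (top h)
  | dl5_empty (h) (a) : Eqv (rres (top h) a) (top h)
  | dl6_empty (h) (a) : Eqv (rres a (bot h)) (top h)
  -- frame conditions: every instance of `s ≤ t`, written as the equation `s ⊓ t = s`
  | frame {s t} (σ : Fin 3 → Fml K V) :
      FrameCond K s t → Eqv (inf (s.subst σ) (t.subst σ)) (s.subst σ)

/-- The congruence as a setoid. -/
def eqvSetoid (K : Kernel) (V : Type w) : Setoid (Fml K V) :=
  ⟨Eqv, ⟨Eqv.refl, Eqv.symm, Eqv.trans⟩⟩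

/-- The distributive full Lambek calculus over the kernel `K`: the free algebra of terms over `V`
modulo the axioms of `K`, the distribution laws and the frame conditions. -/
def DFL (K : Kernel) (V : Type w) : Type w := Quotient (eqvSetoid K V)

/-- The class of a term in the distributive full Lambek calculus. -/
def DFL.mk {K : Kernel} {V : Type w} (a : Fml K V) : DFL K V := Quotient.mk (eqvSetoid K V) a

instance (K : Kernel) (V : Type w) : Min (DFL K V) :=
  ⟨Quotient.map₂ Fml.inf fun _ _ h _ _ h' => Eqv.congr_inf h h'⟩

instance (K : Kernel) (V : Type w) : Max (DFL K V) :=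
  ⟨Quotient.map₂ Fml.sup fun _ _ h _ _ h' => Eqv.congr_sup h h'⟩

/-- The lattice structure of the quotient; in particular `a ≤ b ↔ a ⊔ b = b ↔ a ⊓ b = a`. -/
instance (K : Kernel) (V : Type w) : DistribLattice (DFL K V) :=
  let L : Lattice (DFL K V) := Lattice.mk'
    (by rintro ⟨a⟩ ⟨b⟩; exact Quotient.sound (Eqv.sup_comm a b))
    (by rintro ⟨a⟩ ⟨b⟩ ⟨c⟩; exact Quotient.sound (Eqv.sup_assoc a b c))
    (by rintro ⟨a⟩ ⟨b⟩; exact Quotient.sound (Eqv.inf_comm a b))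
    (by rintro ⟨a⟩ ⟨b⟩ ⟨c⟩; exact Quotient.sound (Eqv.inf_assoc a b c))
    (by rintro ⟨a⟩ ⟨b⟩; exact Quotient.sound (Eqv.sup_inf_self a b))
    (by rintro ⟨a⟩ ⟨b⟩; exact Quotient.sound (Eqv.inf_sup_self a b))
  DistribLattice.ofInfSupLe (α := DFL K V)
    (by
      rintro ⟨a⟩ ⟨b⟩ ⟨c⟩
      exact le_of_eq (Quotient.sound (Eqv.inf_sup_left a b c)))

/-- `Φ ⊢ Ψ`: there are finite `Φ₀ ⊆ Φ` and `Ψ₀ ⊆ Ψ` with `⋀ Φ₀ ≤ ⋁ Ψ₀`. Empty meets and joins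
are allowed exactly if the kernel has bounds, where `⋀ ∅ = ⊤` and `⋁ ∅ = ⊥`. -/
def Entails {K : Kernel} {V : Type w} (Φ Ψ : Set (DFL K V)) : Prop :=
  ∃ Φ₀ Ψ₀ : Finset (DFL K V), (Φ₀ : Set (DFL K V)) ⊆ Φ ∧ (Ψ₀ : Set (DFL K V)) ⊆ Ψ ∧
    (¬ K.HasBounds → Φ₀.Nonempty ∧ Ψ₀.Nonempty) ∧
    ∃ m j, IsGLB (Φ₀ : Set (DFL K V)) m ∧ IsLUB (Ψ₀ : Set (DFL K V)) j ∧ m ≤ j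

/-! ### Coalgebras -/

/-- The upsets of `W`, ordered by inclusion. -/
abbrev Up (W : Type w) [Preorder W] : Type w := {s : Set W // IsUpperSet s}

/-- The inverse image of an upset under a monotone map. -/
def Up.comap {W X : Type w} [Preorder W] [Preorder X] (f : W →o X) (s : Up X) : Up W :=
  ⟨f ⁻¹' s.1, s.2.preimage f.monotone⟩

/-- The convex subsets of a poset. -/
@[ext] structure ConvexPow (X : Type w) [PartialOrder X] : Type w where
  carrier : Set X
  convex : ∀ ⦃x y z : X⦄, x ∈ carrier → z ∈ carrier → x ≤ y → y ≤ z → y ∈ carrier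

/-- The Egli-Milner order on convex subsets. -/
instance (X : Type w) [PartialOrder X] : PartialOrder (ConvexPow X) where
  le U U' := (∀ x ∈ U.carrier, ∃ x' ∈ U'.carrier, x ≤ x') ∧
    (∀ x' ∈ U'.carrier, ∃ x ∈ U.carrier, x ≤ x')
  le_refl U := ⟨fun x hx => ⟨x, hx, le_rfl⟩, fun x hx => ⟨x, hx, le_rfl⟩⟩
  le_trans U U' U'' h h' := by
    refine ⟨fun x hx => ?_, fun x hx => ?_⟩
    · obtain ⟨y, hy, hxy⟩ := h.1 x hx
      obtain ⟨z, hz, hyz⟩ := h'.1 y hy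
      exact ⟨z, hz, hxy.trans hyz⟩
    · obtain ⟨y, hy, hyx⟩ := h'.2 x hx
      obtain ⟨z, hz, hzy⟩ := h.2 y hy
      exact ⟨z, hz, hzy.trans hyx⟩
  le_antisymm U U' h h' := by
    ext x
    constructor
    · intro hx
      obtain ⟨y, hy, hxy⟩ := h.1 x hx
      obtain ⟨z, hz, hzx⟩ := h'.2 x hx
      exact U'.convex hz hy hzx hxy
    · intro hx
      obtain ⟨y, hy, hxy⟩ := h'.1 x hx
      obtain ⟨z, hz, hzx⟩ := h.2 x hx
      exact U.convex hz hy hzx hxy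

/-- `T W = 𝟚 × P_c(W × W) × P_c(Wᵒᵖ × W) × P_c(W × Wᵒᵖ)`. Here `𝟚 = {0, 1}` is ordered by `1 ≤ 0`;
the element `0` marks the unit states, which have to form an upset. -/
abbrev T (W : Type w) [PartialOrder W] : Type w :=
  (Fin 2)ᵒᵈ × ConvexPow (W × W) × ConvexPow (Wᵒᵈ × W) × ConvexPow (W × Wᵒᵈ)

/-- A `T`-coalgebra on the poset `W`. -/
abbrev Coalg (W : Type w) [PartialOrder W] : Type w := W →o T W

section Semantics

variable {W : Type w} [PartialOrder W]

/-- The semantic transformation on `I`. -/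
def deltaI (W : Type w) [PartialOrder W] : Up (T W) :=
  ⟨{t | t.1 = OrderDual.toDual 0}, by
    intro t t' h ht
    have h1 : t.1 ≤ t'.1 := h.1
    change t.1 = _ at ht; change t'.1 = _
    rw [ht] at h1
    have h2 : OrderDual.ofDual t'.1 ≤ 0 := h1
    exact Fin.le_zero_iff.mp h2⟩

/-- The semantic transformation on `u ⊗ v`. -/
def deltaTens (u v : Up W) : Up (T W) :=
  ⟨{t | ∃ p ∈ t.2.1.carrier, p.1 ∈ u.1 ∧ p.2 ∈ v.1}, by
    rintro t t' h ⟨p, hp, hu, hv⟩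
    obtain ⟨p', hp', hpp'⟩ := h.2.1.1 p hp
    exact ⟨p', hp', u.2 hpp'.1 hu, v.2 hpp'.2 hv⟩⟩

/-- The semantic transformation on `u ⊸ s`. -/
def deltaLres (u s : Up W) : Up (T W) :=
  ⟨{t | ∀ p ∈ t.2.2.1.carrier, OrderDual.ofDual p.1 ∈ u.1 → p.2 ∈ s.1}, by
    intro t t' h ht p' hp' hu
    obtain ⟨p, hp, hpp'⟩ := h.2.2.1.2 p' hp'
    exact s.2 hpp'.2 (ht p hp (u.2 (OrderDual.ofDual_le_ofDual.mpr hpp'.1) hu))⟩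

/-- The semantic transformation on `s ⟜ v`. -/
def deltaRres (s v : Up W) : Up (T W) :=
  ⟨{t | ∀ p ∈ t.2.2.2.carrier, OrderDual.ofDual p.2 ∈ v.1 → p.1 ∈ s.1}, by
    intro t t' h ht p' hp' hv
    obtain ⟨p, hp, hpp'⟩ := h.2.2.2.2 p' hp'
    exact s.2 hpp'.1 (ht p hp (v.2 (OrderDual.ofDual_le_ofDual.mpr hpp'.2) hv))⟩

/-- The interpretation of terms as upsets of a coalgebra, under a valuation of the variables.
The complement is the largest disjoint upset; it is used only on discrete posets, where it is the
set complement. -/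
def interp {K : Kernel} {V : Type u} (γ : Coalg W) (v : V → Up W) : Fml K V → Up W
  | .var p => v p
  | .inf a b => ⟨(interp γ v a).1 ∩ (interp γ v b).1, (interp γ v a).2.inter (interp γ v b).2⟩
  | .sup a b => ⟨(interp γ v a).1 ∪ (interp γ v b).1, (interp γ v a).2.union (interp γ v b).2⟩
  | .top _ => ⟨Set.univ, isUpperSet_univ⟩
  | .bot _ => ⟨∅, isUpperSet_empty⟩
  | .compl _ a => ⟨{x | ∀ y, x ≤ y → y ∉ (interp γ v a).1},
      fun _ _ h hx z hz => hx z (h.trans hz)⟩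
  | .I => (deltaI W).comap γ
  | .tens a b => (deltaTens (interp γ v a) (interp γ v b)).comap γ
  | .lres a b => (deltaLres (interp γ v a) (interp γ v b)).comap γ
  | .rres a b => (deltaRres (interp γ v a) (interp γ v b)).comap γ

/-- The coalgebra validates the frame conditions, that is, they hold in its algebra of upsets,
under all valuations of their variables. -/
def ValidatesFC (K : Kernel) (γ : Coalg W) : Prop :=
  ∀ s t, FrameCond K s t → ∀ v : Fin 3 → Up W, interp γ v s ≤ interp γ v t

end Semantics

/-- The posets on which coalgebras for the kernel `K` live: all posets for `DL` and `BDL`, and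
sets, that is discrete posets, for `BA`. -/
def Kernel.IsDomain (K : Kernel) (W : Type w) [PartialOrder W] : Prop :=
  K.HasCompl → ∀ x y : W, x ≤ y → x = y

end RL

/-! The proof is a canonical model construction. Points are the prime filters of the calculus,
ordered by inclusion. One ternary relation, `Comp w x y` (all products from `x` and `y` lie in `w`),
supplies all three convex-set components of the coalgebra. FC1–FC6 make `⊗` an associative unital
operation with residuals `\` and `/`. A squeeze argument (`exists_isPrimeFilt_comp_left`,
`exists_isPrimeFilt_comp_right`) enlarges filters `f`, `g` with `Comp w f g` to prime ones. It
yields the truth lemma `mem_interp_canonical`, and it transfers the unit and associativity laws to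
`Comp`, whence the frame conditions for arbitrary upsets.

The delicate point is monotonicity for the Egli–Milner order. As `w` grows, one half of the order is
inclusion. The other half needs a least point `o` and a greatest point `m`, with `Comp w o o`, `Comp
m o w` and `Comp m w o` for every `w`. For `DL` these are the empty and the full filter. For `BDL`
they are the set consisting of `⊤` and the set of all elements other than `⊥`, so `⊤` must be
join-prime and `⊥` meet-prime. This is proved by a gluing argument in the style of Kleene's slash:
`marks` assigns truth values at three new points to each term, and these values respect the
congruence. For `BA` the prime filters form an antichain and monotonicity is trivial. -/

namespace RL

/-! ### Residuation and associativity in the calculus; prime filters -/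

section Quotient

variable {K : Kernel} {V : Type w}

namespace DFL

instance : Max (DFL K V) := SemilatticeSup.toMax

instance : Min (DFL K V) := SemilatticeInf.toMin

instance : One (DFL K V) := ⟨mk .I⟩

instance : Mul (DFL K V) :=
  ⟨Quotient.map₂ Fml.tens fun _ _ h _ _ h' => Eqv.congr_tens h h'⟩

/-- The left residual `a \ b`. -/
def lres : DFL K V → DFL K V → DFL K V :=
  Quotient.map₂ Fml.lres fun _ _ h _ _ h' => Eqv.congr_lres h h'

/-- The right residual `a / b`. -/
def rres : DFL K V → DFL K V → DFL K V :=
  Quotient.map₂ Fml.rres fun _ _ h _ _ h' => Eqv.congr_rres h h'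

theorem mk_eq_of_eqv {a b : Fml K V} (h : Eqv a b) : mk a = mk b := Quotient.sound h

theorem mk_le_of_frameCond {s t : Fml K (Fin 3)} (h : FrameCond K s t) (σ : Fin 3 → Fml K V) :
    mk (s.subst σ) ≤ mk (t.subst σ) :=
  inf_eq_left.mp (mk_eq_of_eqv (Eqv.frame σ h))

theorem sup_mul (a b c : DFL K V) : (a ⊔ b) * c = a * c ⊔ b * c := by
  rcases a with ⟨a⟩; rcases b with ⟨b⟩; rcases c with ⟨c⟩
  exact mk_eq_of_eqv (Eqv.dl1 a b c)

theorem mul_sup (a b c : DFL K V) : a * (b ⊔ c) = a * b ⊔ a * c := by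
  rcases a with ⟨a⟩; rcases b with ⟨b⟩; rcases c with ⟨c⟩
  exact mk_eq_of_eqv (Eqv.dl2 a b c)

theorem mul_mono {a a' b b' : DFL K V} (h : a ≤ a') (h' : b ≤ b') : a * b ≤ a' * b' := by
  calc a * b ≤ a' * b := by
        rw [← sup_eq_right.mpr h, sup_mul]; exact le_sup_left
    _ ≤ a' * b' := by
        rw [← sup_eq_right.mpr h', mul_sup]; exact le_sup_left

theorem lres_inf (a b c : DFL K V) : lres a (b ⊓ c) = lres a b ⊓ lres a c := by
  rcases a with ⟨a⟩; rcases b with ⟨b⟩; rcases c with ⟨c⟩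
  exact mk_eq_of_eqv (Eqv.dl3 a b c)

theorem inf_rres (a b c : DFL K V) : rres (a ⊓ b) c = rres a c ⊓ rres b c := by
  rcases a with ⟨a⟩; rcases b with ⟨b⟩; rcases c with ⟨c⟩
  exact mk_eq_of_eqv (Eqv.dl5 a b c)

theorem lres_mono {a b b' : DFL K V} (h : b ≤ b') : lres a b ≤ lres a b' := by
  rw [← inf_eq_left.mpr h, lres_inf]; exact inf_le_right

theorem rres_mono {a a' b : DFL K V} (h : a ≤ a') : rres a b ≤ rres a' b := by
  rw [← inf_eq_left.mpr h, inf_rres]; exact inf_le_right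

protected theorem mul_one (a : DFL K V) : a * 1 = a := by
  rcases a with ⟨a⟩
  exact le_antisymm (mk_le_of_frameCond .fc1a fun _ => a) (mk_le_of_frameCond .fc1b fun _ => a)

protected theorem one_mul (a : DFL K V) : 1 * a = a := by
  rcases a with ⟨a⟩
  exact le_antisymm (mk_le_of_frameCond .fc1c fun _ => a) (mk_le_of_frameCond .fc1d fun _ => a)

theorem one_le_lres (a : DFL K V) : 1 ≤ lres a a := by
  rcases a with ⟨a⟩
  exact mk_le_of_frameCond .fc2a fun _ => a

theorem one_le_rres (a : DFL K V) : 1 ≤ rres a a := by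
  rcases a with ⟨a⟩
  exact mk_le_of_frameCond .fc2b fun _ => a

theorem mul_rres_le (a b c : DFL K V) : a * rres b c ≤ rres (a * b) c := by
  rcases a with ⟨a⟩; rcases b with ⟨b⟩; rcases c with ⟨c⟩
  exact mk_le_of_frameCond .fc3 ![a, b, c]

theorem lres_mul_le (a b c : DFL K V) : lres c b * a ≤ lres c (b * a) := by
  rcases a with ⟨a⟩; rcases b with ⟨b⟩; rcases c with ⟨c⟩
  exact mk_le_of_frameCond .fc4 ![a, b, c]

theorem rres_mul_self_le (a b : DFL K V) : rres a b * b ≤ a := by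
  rcases a with ⟨a⟩; rcases b with ⟨b⟩
  -- The third variable does not occur in FC5, so the last entry is arbitrary.
  exact mk_le_of_frameCond .fc5 ![a, b, b]

theorem mul_lres_self_le (a b : DFL K V) : b * lres b a ≤ a := by
  rcases a with ⟨a⟩; rcases b with ⟨b⟩
  exact mk_le_of_frameCond .fc6 ![a, b, b]

/-- One direction is FC6. For the other, FC2 inserts `b \ b` in front of `a` and FC4 moves `a` under
the residual. -/
theorem le_lres_iff {a b c : DFL K V} : a ≤ lres b c ↔ b * a ≤ c := by
  constructor
  · exact fun h => (mul_mono le_rfl h).trans (mul_lres_self_le c b)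
  · intro h
    calc a = 1 * a := (DFL.one_mul a).symm
      _ ≤ lres b b * a := mul_mono (one_le_lres b) le_rfl
      _ ≤ lres b (b * a) := lres_mul_le a b b
      _ ≤ lres b c := lres_mono h

theorem le_rres_iff {a b c : DFL K V} : a ≤ rres c b ↔ a * b ≤ c := by
  constructor
  · exact fun h => (mul_mono h le_rfl).trans (rres_mul_self_le c b)
  · intro h
    calc a = a * 1 := (DFL.mul_one a).symm
      _ ≤ a * rres b b := mul_mono le_rfl (one_le_rres b)
      _ ≤ rres (a * b) b := mul_rres_le a b b
      _ ≤ rres c b := rres_mono h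

/-- Associativity is not among the axioms: by residuation, FC3 and FC4 each amount to one of the two
inequalities. -/
protected theorem mul_assoc (a b c : DFL K V) : a * b * c = a * (b * c) := by
  apply le_antisymm
  · rw [← le_rres_iff]
    exact (mul_mono le_rfl (le_rres_iff.mpr le_rfl)).trans (mul_rres_le a (b * c) c)
  · rw [← le_lres_iff]
    exact (mul_mono (le_lres_iff.mpr le_rfl) le_rfl).trans (lres_mul_le c (a * b) a)

instance : Monoid (DFL K V) where
  mul_assoc := DFL.mul_assoc
  one_mul := DFL.one_mul
  mul_one := DFL.mul_one

theorem le_mk_top (h : K.HasBounds) (a : DFL K V) : a ≤ mk (.top h) := by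
  rcases a with ⟨a⟩
  exact inf_eq_left.mp (mk_eq_of_eqv (Eqv.inf_top h a))

theorem mk_bot_le (h : K.HasBounds) (a : DFL K V) : mk (.bot h) ≤ a := by
  rcases a with ⟨a⟩
  exact sup_eq_left.mp (mk_eq_of_eqv (Eqv.sup_bot h a))

theorem mul_bot (h : K.HasBounds) (a : DFL K V) : a * mk (.bot h) = mk (.bot h) := by
  rcases a with ⟨a⟩
  exact mk_eq_of_eqv (Eqv.dl2_empty h a)

theorem bot_mul (h : K.HasBounds) (a : DFL K V) : mk (.bot h) * a = mk (.bot h) := by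
  rcases a with ⟨a⟩
  exact mk_eq_of_eqv (Eqv.dl1_empty h a)

theorem mk_inf (a b : Fml K V) : mk (.inf a b) = mk a ⊓ mk b := rfl
theorem mk_sup (a b : Fml K V) : mk (.sup a b) = mk a ⊔ mk b := rfl
theorem mk_I : mk (.I : Fml K V) = 1 := rfl
theorem mk_tens (a b : Fml K V) : mk (.tens a b) = mk a * mk b := rfl
theorem mk_lres (a b : Fml K V) : mk (.lres a b) = lres (mk a) (mk b) := rfl
theorem mk_rres (a b : Fml K V) : mk (.rres a b) = rres (mk a) (mk b) := rfl

/-! ### Filters and prime filters -/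

/-- A filter of the calculus; it may be empty if the kernel has no bounds. -/
structure IsFilt (f : Set (DFL K V)) : Prop where
  up : ∀ {a b}, a ≤ b → a ∈ f → b ∈ f
  inf : ∀ {a b}, a ∈ f → b ∈ f → a ⊓ b ∈ f
  top : ∀ h, mk (.top h) ∈ f

/-- An ideal of the calculus; it may be empty if the kernel has no bounds. -/
structure IsIdl (j : Set (DFL K V)) : Prop where
  down : ∀ {a b}, a ≤ b → b ∈ j → a ∈ j
  sup : ∀ {a b}, a ∈ j → b ∈ j → a ⊔ b ∈ j
  bot : ∀ h, mk (.bot h) ∈ j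

/-- A prime filter of the calculus; it may be empty or improper if the kernel has no bounds. -/
structure IsPrimeFilt (f : Set (DFL K V)) : Prop extends IsFilt f where
  prime : ∀ {a b}, a ⊔ b ∈ f → a ∈ f ∨ b ∈ f
  bot : ∀ h, mk (.bot h) ∉ f

/-- The prime filter theorem for distributive lattices. An empty filter or an empty ideal, possible
only without bounds, is handled by the empty or the full prime filter. -/
theorem exists_isPrimeFilt_of_disjoint {f j : Set (DFL K V)} (hf : IsFilt f) (hj : IsIdl j)
    (hd : ∀ a ∈ f, a ∉ j) : ∃ p, IsPrimeFilt p ∧ f ⊆ p ∧ ∀ a ∈ p, a ∉ j := by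
  rcases f.eq_empty_or_nonempty with rfl | hfne
  · exact ⟨∅, ⟨hf, fun h => h.elim, fun _ h => h⟩, subset_rfl, fun _ h => h.elim⟩
  rcases j.eq_empty_or_nonempty with rfl | hjne
  · exact ⟨Set.univ, ⟨⟨fun _ _ => trivial, fun _ _ => trivial, fun _ => trivial⟩,
      fun _ => Or.inl trivial, fun h _ => hj.bot h⟩, Set.subset_univ _, fun _ _ h => h⟩
  let F : Order.PFilter (DFL K V) := Order.IsPFilter.toPFilter (F := f)
    (Order.IsPFilter.of_def hfne
      (fun a ha b hb => ⟨a ⊓ b, hf.inf ha hb, inf_le_left, inf_le_right⟩)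
      (fun h => hf.up h))
  let J : Order.Ideal (DFL K V) :=
    ⟨⟨j, fun _ _ h => hj.down h⟩, hjne,
      fun a ha b hb => ⟨a ⊔ b, hj.sup ha hb, le_sup_left, le_sup_right⟩⟩
  have hFJ : Disjoint (F : Set (DFL K V)) J := Set.disjoint_left.mpr hd
  obtain ⟨P, hP, hJP, hFP⟩ := DistribLattice.prime_ideal_of_disjoint_filter_ideal hFJ
  have hfP : ∀ a ∈ f, a ∉ P := fun a ha haP => Set.disjoint_left.mp hFP ha haP
  refine ⟨{a | a ∉ P}, ⟨⟨fun h ha hb => ha (P.lower h hb), fun ha hb h => ?_,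
    fun h => hfP _ (hf.top h)⟩, fun h => ?_, fun h h' => h' (hJP (hj.bot h))⟩, hfP,
    fun a ha haj => ha (hJP haj)⟩
  · exact (hP.mem_or_mem h).elim ha hb
  · by_contra! hab
    exact h (Order.Ideal.sup_mem (not_not.mp hab.1) (not_not.mp hab.2))

theorem isFilt_Ici (a : DFL K V) : IsFilt (Set.Ici a) :=
  ⟨fun h h' => le_trans h' h, fun h h' => Set.mem_Ici.mpr (le_inf h h'), fun h => le_mk_top h a⟩

theorem isIdl_Iic (a : DFL K V) : IsIdl (Set.Iic a) :=
  ⟨fun h h' => le_trans h h', fun h h' => Set.mem_Iic.mpr (sup_le h h'), fun h => mk_bot_le h a⟩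

/-- The filter generated by the products of elements of two filters. -/
def filtMul (f g : Set (DFL K V)) : Set (DFL K V) := {c | ∃ a ∈ f, ∃ b ∈ g, a * b ≤ c}

theorem IsFilt.filtMul {f g : Set (DFL K V)} (hf : IsFilt f) (hg : IsFilt g) :
    IsFilt (filtMul f g) where
  up := by
    rintro c d hcd ⟨a, ha, b, hb, h⟩
    exact ⟨a, ha, b, hb, h.trans hcd⟩
  inf := by
    rintro c d ⟨a, ha, b, hb, h⟩ ⟨a', ha', b', hb', h'⟩
    exact ⟨a ⊓ a', hf.inf ha ha', b ⊓ b', hg.inf hb hb',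
      le_inf ((mul_mono inf_le_left inf_le_left).trans h)
        ((mul_mono inf_le_right inf_le_right).trans h')⟩
  top h := ⟨_, hf.top h, _, hg.top h, le_mk_top h _⟩

/-- `Comp w f g` says that products of elements of `f` and `g` belong to `w`. -/
def Comp (w f g : Set (DFL K V)) : Prop := ∀ a ∈ f, ∀ b ∈ g, a * b ∈ w

theorem comp_filtMul (f g : Set (DFL K V)) : Comp (filtMul f g) f g :=
  fun a ha b hb => ⟨a, ha, b, hb, le_rfl⟩

/-- Squeeze lemma: the elements `c` with `c * d ∉ w` for some `d ∈ g` form an ideal, because `w` is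
prime and `⊗` preserves joins. A prime filter containing `f` and avoiding this ideal is what is
wanted. -/
theorem exists_isPrimeFilt_comp_left {w f g : Set (DFL K V)} (hw : IsPrimeFilt w)
    (hf : IsFilt f) (hg : IsFilt g) (h : Comp w f g) :
    ∃ p, IsPrimeFilt p ∧ f ⊆ p ∧ Comp w p g := by
  have hj : IsIdl {c | ∃ d ∈ g, c * d ∉ w} := by
    refine ⟨?_, ?_, fun hb => ⟨_, hg.top hb, by rw [bot_mul]; exact hw.bot hb⟩⟩
    · rintro a b hab ⟨d, hd, hbd⟩
      exact ⟨d, hd, fun had => hbd (hw.up (mul_mono hab le_rfl) had)⟩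
    · rintro a b ⟨d, hd, had⟩ ⟨d', hd', hbd⟩
      refine ⟨d ⊓ d', hg.inf hd hd', fun hm => ?_⟩
      rw [sup_mul] at hm
      exact (hw.prime hm).elim (fun hm => had (hw.up (mul_mono le_rfl inf_le_left) hm))
        (fun hm => hbd (hw.up (mul_mono le_rfl inf_le_right) hm))
  obtain ⟨p, hp, hfp, hpj⟩ := exists_isPrimeFilt_of_disjoint hf hj
    (by rintro a ha ⟨d, hd, had⟩; exact had (h a ha d hd))
  refine ⟨p, hp, hfp, fun a ha b hb => ?_⟩
  by_contra hab
  exact hpj a ha ⟨b, hb, hab⟩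

theorem exists_isPrimeFilt_comp_right {w f g : Set (DFL K V)} (hw : IsPrimeFilt w)
    (hf : IsFilt f) (hg : IsFilt g) (h : Comp w f g) :
    ∃ p, IsPrimeFilt p ∧ g ⊆ p ∧ Comp w f p := by
  have hj : IsIdl {c | ∃ d ∈ f, d * c ∉ w} := by
    refine ⟨?_, ?_, fun hb => ⟨_, hf.top hb, by rw [mul_bot]; exact hw.bot hb⟩⟩
    · rintro a b hab ⟨d, hd, hbd⟩
      exact ⟨d, hd, fun had => hbd (hw.up (mul_mono le_rfl hab) had)⟩
    · rintro a b ⟨d, hd, had⟩ ⟨d', hd', hbd⟩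
      refine ⟨d ⊓ d', hf.inf hd hd', fun hm => ?_⟩
      rw [mul_sup] at hm
      exact (hw.prime hm).elim (fun hm => had (hw.up (mul_mono inf_le_left le_rfl) hm))
        (fun hm => hbd (hw.up (mul_mono inf_le_right le_rfl) hm))
  obtain ⟨p, hp, hgp, hpj⟩ := exists_isPrimeFilt_of_disjoint hg hj
    (by rintro a ha ⟨d, hd, had⟩; exact had (h d hd a ha))
  refine ⟨p, hp, hgp, fun a ha b hb => ?_⟩
  by_contra hab
  exact hpj b hb ⟨a, ha, hab⟩

/-- A set of premises that does not entail a set of conclusions is separated from it by a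
prime filter. -/
theorem exists_isPrimeFilt_of_not_entails {Φ Ψ : Set (DFL K V)} (h : ¬ Entails Φ Ψ) :
    ∃ p, IsPrimeFilt p ∧ Φ ⊆ p ∧ ∀ b ∈ Ψ, b ∉ p := by
  classical
  -- The filter generated by `Φ` and the ideal generated by `Ψ`; a common element would witness
  -- `Entails Φ Ψ`.
  let f : Set (DFL K V) := {c | ∃ s : Finset (DFL K V), (s : Set (DFL K V)) ⊆ Φ ∧
    (¬ K.HasBounds → s.Nonempty) ∧ ∃ m, IsGLB (s : Set (DFL K V)) m ∧ m ≤ c}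
  let j : Set (DFL K V) := {c | ∃ s : Finset (DFL K V), (s : Set (DFL K V)) ⊆ Ψ ∧
    (¬ K.HasBounds → s.Nonempty) ∧ ∃ m, IsLUB (s : Set (DFL K V)) m ∧ c ≤ m}
  have hf : IsFilt f := by
    refine ⟨?_, ?_, fun hb => ⟨∅, by simp, fun h => (h hb).elim, mk (.top hb), ?_, le_rfl⟩⟩
    · rintro a b hab ⟨s, hs, hne, m, hm, hma⟩
      exact ⟨s, hs, hne, m, hm, hma.trans hab⟩
    · rintro a b ⟨s, hs, hne, m, hm, hma⟩ ⟨t, ht, hne', n, hn, hnb⟩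
      refine ⟨s ∪ t, by simp [hs, ht], fun hb => (hne hb).mono Finset.subset_union_left, m ⊓ n,
        ?_, inf_le_inf hma hnb⟩
      rw [Finset.coe_union]; exact hm.union hn
    · exact ⟨by simp [lowerBounds], fun c _ => le_mk_top hb c⟩
  have hj : IsIdl j := by
    refine ⟨?_, ?_, fun hb => ⟨∅, by simp, fun h => (h hb).elim, mk (.bot hb), ?_, le_rfl⟩⟩
    · rintro a b hab ⟨s, hs, hne, m, hm, hma⟩
      exact ⟨s, hs, hne, m, hm, hab.trans hma⟩
    · rintro a b ⟨s, hs, hne, m, hm, hma⟩ ⟨t, ht, hne', n, hn, hnb⟩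
      refine ⟨s ∪ t, by simp [hs, ht], fun hb => (hne hb).mono Finset.subset_union_left, m ⊔ n,
        ?_, sup_le_sup hma hnb⟩
      rw [Finset.coe_union]; exact hm.union hn
    · exact ⟨by simp [upperBounds], fun c _ => mk_bot_le hb c⟩
  obtain ⟨p, hp, hfp, hpj⟩ := exists_isPrimeFilt_of_disjoint hf hj (by
    rintro a ⟨s, hs, hne, m, hm, hma⟩ ⟨t, ht, hne', n, hn, hnb⟩
    exact h ⟨s, t, hs, ht, fun hb => ⟨hne hb, hne' hb⟩, m, n, hm, hn, hma.trans hnb⟩)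
  refine ⟨p, hp, fun a ha => hfp ⟨{a}, by simpa, by simp, a, by simp, le_rfl⟩,
    fun b hb hbp => hpj b hbp ⟨{b}, by simpa, by simp, b, by simp, le_rfl⟩⟩

end DFL

end Quotient

/-! ### Join-primality of `⊤` and meet-primality of `⊥` in the bounded calculus -/

section BoundedPrimality

variable {V : Type w}

theorem bdl_hasBounds : Kernel.BDL.HasBounds := trivial

/-- Truth values of a term at three points added to the dual space of the bounded calculus: a
least point, a neutral point for fusion, and a greatest point. -/
@[ext] structure Marks where
  /-- truth at the least point -/
  z : Prop
  /-- truth at the neutral point -/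
  e : Prop
  /-- truth at the greatest point -/
  n : Prop

/-- The truth values of a term at the three added points. -/
def marks : Fml .BDL V → Marks
  -- With these values every condition of `Marks.Fits` holds whatever the class of the variable.
  | .var _ => ⟨False, False, True⟩
  | .inf a b => ⟨(marks a).z ∧ (marks b).z, (marks a).e ∧ (marks b).e, (marks a).n ∧ (marks b).n⟩
  | .sup a b => ⟨(marks a).z ∨ (marks b).z, (marks a).e ∨ (marks b).e, (marks a).n ∨ (marks b).n⟩
  | .top _ => ⟨True, True, True⟩
  | .bot _ => ⟨False, False, False⟩
  | .compl h _ => h.elim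
  | .I => ⟨False, True, True⟩
  -- The clauses on marks come from composing with the neutral point `e`; the clauses on classes
  -- record what the old points, the prime filters, contribute.
  | .tens a b =>
    ⟨(marks a).z ∧ (marks b).e ∨ (marks a).e ∧ (marks b).z,
      (marks a).e ∧ (marks b).e,
      ¬ DFL.mk a * DFL.mk b ≤ DFL.mk (.bot bdl_hasBounds) ∨ (marks a).e ∧ (marks b).n ∨
        (marks a).n ∧ (marks b).e⟩
  | .lres a b =>
    ⟨DFL.mk a * DFL.mk (.top bdl_hasBounds) ≤ DFL.mk b ∧ ((marks a).e → (marks b).z) ∧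
        ((marks a).n → (marks b).n),
      DFL.mk a ≤ DFL.mk b ∧ ((marks a).z → (marks b).z) ∧ ((marks a).e → (marks b).e) ∧
        ((marks a).n → (marks b).n),
      (marks a).e → (marks b).n⟩
  | .rres b a =>
    ⟨DFL.mk (.top bdl_hasBounds) * DFL.mk a ≤ DFL.mk b ∧ ((marks a).e → (marks b).z) ∧
        ((marks a).n → (marks b).n),
      DFL.mk a ≤ DFL.mk b ∧ ((marks a).z → (marks b).z) ∧ ((marks a).e → (marks b).e) ∧
        ((marks a).n → (marks b).n),
      (marks a).e → (marks b).n⟩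

/-- The compatibility of truth values at the added points with a class of the calculus. -/
structure Marks.Fits (m : Marks) (q : DFL .BDL V) : Prop where
  top_le : m.z → DFL.mk (.top bdl_hasBounds) ≤ q
  one_le : m.e → 1 ≤ q
  le_bot : ¬ m.n → q ≤ DFL.mk (.bot bdl_hasBounds)
  e_of_z : m.z → m.e
  n_of_e : m.e → m.n

-- This links truth at the new points to the order of the calculus: truth at `z` forces the class to
-- be `⊤`, and falsity at `n` forces it to be `⊥`. Primality then follows from truth at a single
-- point commuting with `∨` and `∧`.
open DFL in
theorem marks_fits (a : Fml .BDL V) : (marks a).Fits (DFL.mk a) := by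
  have hone : ∀ q : DFL .BDL V, q ≤ q * mk (.top bdl_hasBounds) := fun q => by
    conv_lhs => rw [← mul_one q]
    exact mul_mono le_rfl (le_mk_top _ _)
  have hone' : ∀ q : DFL .BDL V, q ≤ mk (.top bdl_hasBounds) * q := fun q => by
    conv_lhs => rw [← one_mul q]
    exact mul_mono (le_mk_top _ _) le_rfl
  induction a with
  | var p => exact ⟨False.elim, False.elim, fun h => (h trivial).elim, id, fun _ => trivial⟩
  | inf a b iha ihb =>
    rw [mk_inf]
    refine ⟨fun h => le_inf (iha.1 h.1) (ihb.1 h.2), fun h => le_inf (iha.2 h.1) (ihb.2 h.2),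
      fun h => ?_, fun h => ⟨iha.4 h.1, ihb.4 h.2⟩, fun h => ⟨iha.5 h.1, ihb.5 h.2⟩⟩
    by_cases ha : (marks a).n
    · exact inf_le_right.trans (ihb.3 fun hb => h ⟨ha, hb⟩)
    · exact inf_le_left.trans (iha.3 ha)
  | sup a b iha ihb =>
    rw [mk_sup]
    refine ⟨fun h => h.elim (fun h => (iha.1 h).trans le_sup_left)
        (fun h => (ihb.1 h).trans le_sup_right),
      fun h => h.elim (fun h => (iha.2 h).trans le_sup_left)
        (fun h => (ihb.2 h).trans le_sup_right),
      fun h => sup_le (iha.3 fun h' => h (Or.inl h')) (ihb.3 fun h' => h (Or.inr h')),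
      Or.imp iha.4 ihb.4, Or.imp iha.5 ihb.5⟩
  | top h => exact ⟨fun _ => le_rfl, fun _ => le_mk_top _ _, fun h => (h trivial).elim, id, id⟩
  | bot h => exact ⟨False.elim, False.elim, fun _ => le_rfl, id, id⟩
  | compl h _ _ => exact h.elim
  | I => exact ⟨False.elim, fun _ => le_rfl, fun h => (h trivial).elim, fun _ => trivial, id⟩
  | tens a b iha ihb =>
    rw [mk_tens]
    refine ⟨?_, fun h => ?_, fun h => ?_, ?_, fun h => Or.inr (Or.inl ⟨h.1, ihb.5 h.2⟩)⟩
    · rintro (⟨h, h'⟩ | ⟨h, h'⟩)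
      · simpa using mul_mono (iha.1 h) (ihb.2 h')
      · simpa using mul_mono (iha.2 h) (ihb.1 h')
    · simpa using mul_mono (iha.2 h.1) (ihb.2 h.2)
    · by_contra h'; exact h (Or.inl h')
    · rintro (⟨h, h'⟩ | ⟨h, h'⟩)
      · exact ⟨iha.4 h, h'⟩
      · exact ⟨h, ihb.4 h'⟩
  | lres a b iha ihb =>
    rw [mk_lres]
    refine ⟨fun h => le_lres_iff.mpr h.1, fun h => le_lres_iff.mpr (by simpa using h.1),
      fun h => ?_, fun h => ⟨(hone _).trans h.1, fun h' => h.2.1 (iha.4 h'),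
        fun h' => ihb.4 (h.2.1 h'), h.2.2⟩, fun h h' => ihb.5 (h.2.2.1 h')⟩
    change ¬ (_ → _) at h
    push Not at h
    -- Here `1 ≤ a` and `b ≤ ⊥`, so `a \ b ≤ a ⊗ (a \ b) ≤ b ≤ ⊥`.
    have := (mul_mono (iha.2 h.1) le_rfl).trans (mul_lres_self_le (mk b) (mk a))
    rw [one_mul] at this
    exact this.trans (ihb.3 h.2)
  | rres b a ihb iha =>
    rw [mk_rres]
    refine ⟨fun h => le_rres_iff.mpr h.1, fun h => le_rres_iff.mpr (by simpa using h.1),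
      fun h => ?_, fun h => ⟨(hone' _).trans h.1, fun h' => h.2.1 (iha.4 h'),
        fun h' => ihb.4 (h.2.1 h'), h.2.2⟩, fun h h' => ihb.5 (h.2.2.1 h')⟩
    change ¬ (_ → _) at h
    push Not at h
    have := (mul_mono le_rfl (iha.2 h.1)).trans (rres_mul_self_le (mk b) (mk a))
    rw [mul_one] at this
    exact this.trans (ihb.3 h.2)

/-- The order of truth values. -/
def Marks.Le (m m' : Marks) : Prop := (m.z → m'.z) ∧ (m.e → m'.e) ∧ (m.n → m'.n)

open DFL in
theorem marks_le_of_frameCond {s t : Fml .BDL (Fin 3)} (h : FrameCond .BDL s t)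
    (σ : Fin 3 → Fml .BDL V) : (marks (s.subst σ)).Le (marks (t.subst σ)) := by
  obtain ⟨ha1, ha2, ha3, ha4, ha5⟩ := marks_fits (σ 0)
  obtain ⟨hb1, hb2, hb3, hb4, hb5⟩ := marks_fits (σ 1)
  obtain ⟨hc1, hc2, hc3, hc4, hc5⟩ := marks_fits (σ 2)
  cases h <;> simp only [Marks.Le, Fml.subst, marks, mk_tens, mk_lres, mk_rres, mk_I, mul_one,
    one_mul, le_refl]
  case fc3 =>
    -- The class inequalities behind the three marks: `h1` and `h2` serve `z`, `h3` serves `e`, and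
    -- `h4` serves `n` by contraposition.
    have h1 := fun h h' => mul_mono (K := .BDL) (V := V) (a := mk (.top bdl_hasBounds))
      (a' := mk (σ 0)) (b := mk (σ 2)) (b' := mk (σ 1)) h h'
    have h2 := fun h h' => mul_mono (K := .BDL) (V := V) (a := 1) (a' := mk (σ 0))
      (b := mk (.top bdl_hasBounds) * mk (σ 2)) (b' := mk (σ 1)) h h'
    have h3 := fun h h' => mul_mono (K := .BDL) (V := V) (a := 1) (a' := mk (σ 0))
      (b := mk (σ 2)) (b' := mk (σ 1)) h h'
    have h4 : 1 ≤ mk (σ 2) → mk (σ 0) * mk (σ 1) ≤ mk (.bot bdl_hasBounds) →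
        mk (σ 0) * rres (mk (σ 1)) (mk (σ 2)) ≤ mk (.bot bdl_hasBounds) := fun h h' => by
      refine le_trans (mul_mono le_rfl ?_) h'
      simpa using (mul_mono (le_refl (rres (mk (σ 1)) (mk (σ 2)))) h).trans
        (rres_mul_self_le _ _)
    rw [one_mul] at h2 h3
    grind
  case fc4 =>
    have h1 := fun h h' => mul_mono (K := .BDL) (V := V) (b := mk (.top bdl_hasBounds))
      (b' := mk (σ 0)) (a := mk (σ 2)) (a' := mk (σ 1)) h h'
    have h2 := fun h h' => mul_mono (K := .BDL) (V := V) (b := 1) (b' := mk (σ 0))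
      (a := mk (σ 2) * mk (.top bdl_hasBounds)) (a' := mk (σ 1)) h h'
    have h3 := fun h h' => mul_mono (K := .BDL) (V := V) (b := 1) (b' := mk (σ 0))
      (a := mk (σ 2)) (a' := mk (σ 1)) h h'
    have h4 : 1 ≤ mk (σ 2) → mk (σ 1) * mk (σ 0) ≤ mk (.bot bdl_hasBounds) →
        lres (mk (σ 2)) (mk (σ 1)) * mk (σ 0) ≤ mk (.bot bdl_hasBounds) := fun h h' => by
      refine le_trans (mul_mono ?_ le_rfl) h'
      simpa using (mul_mono h (le_refl (lres (mk (σ 2)) (mk (σ 1))))).trans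
        (mul_lres_self_le _ _)
    rw [mul_one] at h2 h3
    grind
  case fc5 =>
    have := rres_mul_self_le (mk (σ 0)) (mk (σ 1))
    grind
  case fc6 =>
    have := mul_lres_self_le (mk (σ 0)) (mk (σ 1))
    grind
  all_goals grind

-- Since the definition of `marks` mentions classes as well as marks, the congruence cases use both
-- the equality of classes and the induction hypotheses.
open DFL in
theorem marks_eq_of_eqv {a b : Fml .BDL V} (h : Eqv a b) : marks a = marks b := by
  induction h with
  | refl a => rfl
  | symm _ ih => exact ih.symm
  | trans _ _ ih ih' => exact ih.trans ih'
  | congr_inf _ _ ih ih' => simp only [marks, ih, ih']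
  | congr_sup _ _ ih ih' => simp only [marks, ih, ih']
  | congr_compl h => exact h.elim
  | congr_tens h h' ih ih' => simp only [marks, ih, ih', mk_eq_of_eqv h, mk_eq_of_eqv h']
  | congr_lres h h' ih ih' => simp only [marks, ih, ih', mk_eq_of_eqv h, mk_eq_of_eqv h']
  | congr_rres h h' ih ih' => simp only [marks, ih, ih', mk_eq_of_eqv h, mk_eq_of_eqv h']
  | inf_compl h => exact h.elim
  | sup_compl h => exact h.elim
  | frame σ h =>
    have := marks_le_of_frameCond h σ
    simp only [marks, Marks.Le] at this ⊢
    ext <;> grind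
  | dl1 x y a =>
    simp only [marks, mk_sup, sup_mul, sup_le_iff]
    ext <;> grind
  | dl2 x y a =>
    simp only [marks, mk_sup, mul_sup, sup_le_iff]
    ext <;> grind
  | dl3 a x y =>
    simp only [marks, mk_inf, le_inf_iff]
    ext <;> grind
  | dl4 x y a =>
    simp only [marks, mk_sup, sup_mul, sup_le_iff]
    ext <;> grind
  | dl5 x y a =>
    simp only [marks, mk_inf, le_inf_iff]
    ext <;> grind
  | dl6 a x y =>
    simp only [marks, mk_sup, mul_sup, sup_le_iff]
    ext <;> grind
  | dl1_empty h a =>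
    simp [marks, bot_mul]
  | dl2_empty h a =>
    simp [marks, mul_bot]
  | dl3_empty h a =>
    simp [marks, le_mk_top]
  | dl4_empty h a =>
    simp [marks, bot_mul, mk_bot_le]
  | dl5_empty h a =>
    simp [marks, le_mk_top]
  | dl6_empty h a =>
    simp [marks, mul_bot, mk_bot_le]
  | _ => simp only [marks]; ext <;> grind

open DFL in
theorem marks_eq_of_mk_eq {a b : Fml .BDL V} (h : mk a = mk b) : marks a = marks b :=
  marks_eq_of_eqv (Quotient.exact h)

open DFL in
/-- The greatest element of the bounded calculus is join-prime. -/
theorem isPrimeFilt_singleton_top :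
    IsPrimeFilt {q : DFL .BDL V | mk (.top bdl_hasBounds) ≤ q} where
  up h h' := le_trans h' h
  inf h h' := Set.mem_Ici.mpr (le_inf h h')
  top _ := le_refl (mk (.top bdl_hasBounds))
  prime := by
    rintro ⟨a⟩ ⟨b⟩ h
    have h1 : (marks (.sup a b)).z := by
      rw [marks_eq_of_mk_eq (b := .top bdl_hasBounds) (le_antisymm (le_mk_top _ _) h)]
      trivial
    exact h1.imp (marks_fits a).top_le (marks_fits b).top_le
  bot h h' := by
    have := marks_eq_of_mk_eq (le_antisymm (mk_bot_le h _) h')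
    simp [marks] at this

open DFL in
/-- The least element of the bounded calculus is meet-prime. -/
theorem isPrimeFilt_compl_bot :
    IsPrimeFilt {q : DFL .BDL V | ¬ q ≤ mk (.bot bdl_hasBounds)} where
  up h h' h'' := h' (h.trans h'')
  inf := by
    rintro ⟨a⟩ ⟨b⟩ ha hb h
    have h1 : ¬ (marks (.inf a b)).n := by
      rw [marks_eq_of_mk_eq (b := .bot bdl_hasBounds) (le_antisymm h (mk_bot_le _ _))]
      exact id
    exact h1 ⟨by_contra fun h => ha ((marks_fits a).le_bot h),
      by_contra fun h => hb ((marks_fits b).le_bot h)⟩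
  top _ h' := isPrimeFilt_singleton_top.bot bdl_hasBounds h'
  prime h := by
    by_contra! hab
    exact h (sup_le (not_not.mp hab.1) (not_not.mp hab.2))
  bot _ h := h le_rfl

end BoundedPrimality
open DFL

/-! ### The canonical coalgebra -/

section Canonical

variable (K : Kernel) (V : Type w)

/-- The points of the canonical coalgebra: prime filters, ordered by inclusion. -/
abbrev Point : Type w := {p : Set (DFL K V) // IsPrimeFilt p}

variable {K V}

/-- Without complements, there are a least and a greatest prime filter, and they can be used to
decompose every prime filter and to compose every prime filter to the greatest one. -/
theorem exists_extreme_points (h : ¬ K.HasCompl) : ∃ o m : Point K V,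
    (∀ w : Point K V, o ≤ w ∧ w ≤ m ∧ Comp w.1 o.1 o.1 ∧ Comp m.1 o.1 w.1 ∧ Comp m.1 w.1 o.1) := by
  cases K with
  | DL =>
    refine ⟨⟨∅, ⟨⟨fun _ h => h, fun h => h.elim, fun h => h.elim⟩, fun h => h.elim,
        fun h => h.elim⟩⟩,
      ⟨Set.univ, ⟨⟨fun _ _ => trivial, fun _ _ => trivial, fun _ => trivial⟩,
        fun _ => Or.inl trivial, fun h => h.elim⟩⟩, fun w => ⟨Set.empty_subset _,
        Set.subset_univ _, fun _ h => h.elim, fun _ h => h.elim, fun _ _ _ h => h.elim⟩⟩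
  | BDL =>
    have hbot : ∀ w : Point .BDL V, ∀ b ∈ w.1, ¬ b ≤ mk (.bot bdl_hasBounds) :=
      fun w b hb h => w.2.bot _ (w.2.up h hb)
    refine ⟨⟨_, isPrimeFilt_singleton_top⟩, ⟨_, isPrimeFilt_compl_bot⟩, fun w =>
      ⟨fun a ha => w.2.up ha (w.2.top _), hbot w, fun a ha b hb => ?_,
        fun a ha b hb h => ?_, fun a ha b hb h => ?_⟩⟩
    · refine w.2.up ?_ (w.2.top bdl_hasBounds)
      have := mul_mono ha ((le_mk_top bdl_hasBounds 1).trans hb)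
      rwa [mul_one] at this
    · have := mul_mono ((le_mk_top bdl_hasBounds 1).trans ha) (le_refl b)
      rw [one_mul] at this
      exact hbot w b hb (this.trans h)
    · have := mul_mono (le_refl a) ((le_mk_top bdl_hasBounds 1).trans hb)
      rw [mul_one] at this
      exact hbot w a ha (this.trans h)
  | BA => exact (h trivial).elim

/-- Prime filters of a Boolean algebra are maximal: each contains every element or its complement.
-/
theorem isDomain_point : K.IsDomain (Point K V) := by
  intro h p q hpq
  have hb : K.HasBounds := by cases K <;> first | exact h.elim | trivial
  refine le_antisymm hpq fun a ha => ?_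
  rcases a with ⟨a⟩
  by_contra hap
  have h1 : mk a ⊔ mk (.compl h a) ∈ p.1 := by
    have h2 : mk a ⊔ mk (.compl h a) = mk (.top hb) := mk_eq_of_eqv (Eqv.sup_compl h hb a)
    rw [h2]; exact p.2.top hb
  have h3 : mk a ⊓ mk (.compl h a) ∈ q.1 := q.2.inf ha (hpq ((p.2.prime h1).resolve_left hap))
  have h4 : mk a ⊓ mk (.compl h a) = mk (.bot hb) := mk_eq_of_eqv (Eqv.inf_compl h hb a)
  rw [h4] at h3
  exact q.2.bot hb h3

theorem DFL.Comp.mono {w w' x x' y y' : Point K V} (h : Comp w.1 x.1 y.1) (hw : w ≤ w') (hx : x' ≤ x)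
    (hy : y' ≤ y) : Comp w'.1 x'.1 y'.1 :=
  fun a ha b hb => hw (h a (hx ha) b (hy hb))

variable (K V) in
open Classical in
/-- The canonical coalgebra. -/
noncomputable def canonical : Coalg (Point K V) where
  toFun w :=
    (OrderDual.toDual (if (1 : DFL K V) ∈ w.1 then 0 else 1),
      -- `Comp` is antitone in the factors and monotone in the result. So this set is a downset, and
      -- the two for the residuals are upsets once the order of the factor is reversed; convexity
      -- follows.
      ⟨{p | Comp w.1 p.1.1 p.2.1}, fun _ _ _ _ hz _ hyz => hz.mono le_rfl hyz.1 hyz.2⟩,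
      ⟨{p | Comp p.2.1 (OrderDual.ofDual p.1).1 w.1},
        fun _ _ _ hx _ hxy _ => hx.mono hxy.2 hxy.1 le_rfl⟩,
      ⟨{p | Comp p.1.1 w.1 (OrderDual.ofDual p.2).1},
        fun _ _ _ hx _ hxy _ => hx.mono hxy.1 le_rfl hxy.2⟩)
  monotone' := by
    intro w w' hw
    by_cases hK : K.HasCompl
    · rw [isDomain_point hK w w' hw]
    obtain ⟨o, m, hom⟩ := exists_extreme_points (V := V) hK
    -- In each component one half of the Egli–Milner order is an inclusion; the other is witnessed
    -- by a pair of extreme points, independent of `p`.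
    refine ⟨?_, ⟨fun p hp => ⟨p, hp.mono hw le_rfl le_rfl, le_rfl⟩,
      fun p _ => ⟨(o, o), (hom w).2.2.1, (hom _).1, (hom _).1⟩⟩,
      ⟨fun p _ => ⟨(OrderDual.toDual o, m), (hom w').2.2.2.1, (hom _).1, (hom _).2.1⟩,
        fun p hp => ⟨p, hp.mono le_rfl le_rfl hw, le_rfl⟩⟩,
      ⟨fun p _ => ⟨(m, OrderDual.toDual o), (hom w').2.2.2.2, (hom _).2.1, (hom _).1⟩,
        fun p hp => ⟨p, hp.mono le_rfl hw le_rfl, le_rfl⟩⟩⟩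
    change (if (1 : DFL K V) ∈ w'.1 then (0 : Fin 2) else 1) ≤ if 1 ∈ w.1 then 0 else 1
    by_cases h : 1 ∈ w.1
    · rw [if_pos h, if_pos (hw h)]
    · rw [if_neg h]; exact Fin.le_last _

theorem mem_deltaI_comap {w : Point K V} :
    w ∈ ((deltaI (Point K V)).comap (canonical K V)).1 ↔ 1 ∈ w.1 := by
  classical
  change (if (1 : DFL K V) ∈ w.1 then (0 : Fin 2) else 1) = 0 ↔ _
  split_ifs with h <;> simp [h]

theorem mem_deltaTens_comap {u v : Up (Point K V)} {w : Point K V} :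
    w ∈ ((deltaTens u v).comap (canonical K V)).1 ↔
      ∃ x y, Comp w.1 x.1 y.1 ∧ x ∈ u.1 ∧ y ∈ v.1 :=
  ⟨fun ⟨p, hp, hu, hv⟩ => ⟨p.1, p.2, hp, hu, hv⟩, fun ⟨x, y, h, hu, hv⟩ => ⟨(x, y), h, hu, hv⟩⟩

theorem mem_deltaLres_comap {u s : Up (Point K V)} {w : Point K V} :
    w ∈ ((deltaLres u s).comap (canonical K V)).1 ↔
      ∀ x z : Point K V, Comp z.1 x.1 w.1 → x ∈ u.1 → z ∈ s.1 :=
  ⟨fun h x z hc => h (OrderDual.toDual x, z) hc, fun h _ hp => h _ _ hp⟩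

theorem mem_deltaRres_comap {s v : Up (Point K V)} {w : Point K V} :
    w ∈ ((deltaRres s v).comap (canonical K V)).1 ↔
      ∀ y z : Point K V, Comp z.1 w.1 y.1 → y ∈ v.1 → z ∈ s.1 :=
  ⟨fun h y z hc => h (z, OrderDual.toDual y) hc, fun h _ hp => h _ _ hp⟩

/-! ### Unit and associativity laws of the relation `Comp`, and the frame conditions -/

theorem DFL.Comp.le_of_one_mem_right {w x y : Point K V} (h : Comp w.1 x.1 y.1) (hy : 1 ∈ y.1) :
    x ≤ w := fun a ha => by simpa using h a ha 1 hy

theorem DFL.Comp.le_of_one_mem_left {w x y : Point K V} (h : Comp w.1 x.1 y.1) (hx : 1 ∈ x.1) :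
    y ≤ w := fun a ha => by simpa using h 1 hx a ha

theorem exists_right_unit (w : Point K V) : ∃ y : Point K V, 1 ∈ y.1 ∧ Comp w.1 w.1 y.1 := by
  obtain ⟨y, hy, h1y, h⟩ := exists_isPrimeFilt_comp_right w.2 w.2.toIsFilt (isFilt_Ici 1)
    (fun a ha b hb => w.2.up (by simpa using mul_mono (le_refl a) hb) ha)
  exact ⟨⟨y, hy⟩, h1y Set.self_mem_Ici, h⟩

theorem exists_left_unit (w : Point K V) : ∃ x : Point K V, 1 ∈ x.1 ∧ Comp w.1 x.1 w.1 := by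
  obtain ⟨x, hx, h1x, h⟩ := exists_isPrimeFilt_comp_left w.2 (isFilt_Ici 1) w.2.toIsFilt
    (fun a ha b hb => w.2.up (by simpa using mul_mono ha (le_refl b)) hb)
  exact ⟨⟨x, hx⟩, h1x Set.self_mem_Ici, h⟩

/-- The filter generated by products from `x` and `y` composes with `z` into `w` by associativity;
squeezing makes it prime. -/
theorem exists_comp_assoc_left {w x y z t : Point K V} (h : Comp w.1 x.1 t.1)
    (ht : Comp t.1 y.1 z.1) : ∃ s : Point K V, Comp s.1 x.1 y.1 ∧ Comp w.1 s.1 z.1 := by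
  obtain ⟨s, hs, hxs, hsz⟩ := exists_isPrimeFilt_comp_left w.2
    (x.2.toIsFilt.filtMul y.2.toIsFilt) z.2.toIsFilt (by
      rintro c ⟨a, ha, b, hb, hc⟩ d hd
      refine w.2.up (mul_mono hc le_rfl) ?_
      rw [mul_assoc]
      exact h a ha _ (ht b hb d hd))
  exact ⟨⟨s, hs⟩, fun a ha b hb => hxs (comp_filtMul _ _ a ha b hb), hsz⟩

theorem exists_comp_assoc_right {w x y z s : Point K V} (h : Comp w.1 s.1 z.1)
    (hs : Comp s.1 x.1 y.1) : ∃ t : Point K V, Comp t.1 y.1 z.1 ∧ Comp w.1 x.1 t.1 := by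
  obtain ⟨t, ht, hyt, hxt⟩ := exists_isPrimeFilt_comp_right w.2
    x.2.toIsFilt (y.2.toIsFilt.filtMul z.2.toIsFilt) (by
      rintro d hd c ⟨a, ha, b, hb, hc⟩
      refine w.2.up (mul_mono le_rfl hc) ?_
      rw [← mul_assoc]
      exact h _ (hs d hd a ha) b hb)
  exact ⟨⟨t, ht⟩, fun a ha b hb => hyt (comp_filtMul _ _ a ha b hb), hxt⟩

theorem validatesFC_canonical : ValidatesFC K (canonical K V) := by
  intro s t h v w hw
  cases h
  case fc1a =>
    obtain ⟨x, y, hc, hx, hy⟩ := mem_deltaTens_comap.mp hw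
    exact (v 0).2 (hc.le_of_one_mem_right (mem_deltaI_comap.mp hy)) hx
  case fc1b =>
    obtain ⟨y, hy, hc⟩ := exists_right_unit w
    exact mem_deltaTens_comap.mpr ⟨w, y, hc, hw, mem_deltaI_comap.mpr hy⟩
  case fc1c =>
    obtain ⟨x, y, hc, hx, hy⟩ := mem_deltaTens_comap.mp hw
    exact (v 0).2 (hc.le_of_one_mem_left (mem_deltaI_comap.mp hx)) hy
  case fc1d =>
    obtain ⟨x, hx, hc⟩ := exists_left_unit w
    exact mem_deltaTens_comap.mpr ⟨x, w, hc, mem_deltaI_comap.mpr hx, hw⟩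
  case fc2a =>
    exact mem_deltaLres_comap.mpr fun x z hc hx =>
      (v 0).2 (hc.le_of_one_mem_right (mem_deltaI_comap.mp hw)) hx
  case fc2b =>
    exact mem_deltaRres_comap.mpr fun y z hc hy =>
      (v 0).2 (hc.le_of_one_mem_left (mem_deltaI_comap.mp hw)) hy
  case fc3 =>
    obtain ⟨x, y, hc, hx, hy⟩ := mem_deltaTens_comap.mp hw
    refine mem_deltaRres_comap.mpr fun c z hz hcv => ?_
    -- Here `z` is composed as `(x y) c`; rebracketing to `x (y c)` gives a point `t` for `y c`, at
    -- which the residual held at `y` can be used.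
    obtain ⟨t, ht, hxt⟩ := exists_comp_assoc_right hz hc
    exact mem_deltaTens_comap.mpr ⟨x, t, hxt, hx, mem_deltaRres_comap.mp hy c t ht hcv⟩
  case fc4 =>
    obtain ⟨x, y, hc, hx, hy⟩ := mem_deltaTens_comap.mp hw
    refine mem_deltaLres_comap.mpr fun c z hz hcv => ?_
    obtain ⟨t, ht, hty⟩ := exists_comp_assoc_left hz hc
    exact mem_deltaTens_comap.mpr ⟨t, y, hty, mem_deltaLres_comap.mp hx c t ht hcv, hy⟩
  case fc5 =>
    obtain ⟨x, y, hc, hx, hy⟩ := mem_deltaTens_comap.mp hw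
    exact mem_deltaRres_comap.mp hx y w hc hy
  case fc6 =>
    obtain ⟨x, y, hc, hx, hy⟩ := mem_deltaTens_comap.mp hw
    exact mem_deltaLres_comap.mp hy x w hc hx

/-! ### The truth lemma -/

/-- The canonical valuation. -/
def canonicalVal (p : V) : Up (Point K V) := ⟨{w | mk (.var p) ∈ w.1}, fun _ _ h hw => h hw⟩

theorem mul_mem_iff {a b : DFL K V} {w : Point K V} :
    a * b ∈ w.1 ↔ ∃ x y : Point K V, Comp w.1 x.1 y.1 ∧ a ∈ x.1 ∧ b ∈ y.1 := by
  refine ⟨fun h => ?_, fun ⟨x, y, hc, hx, hy⟩ => hc a hx b hy⟩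
  obtain ⟨x, hx, hax, hxb⟩ := exists_isPrimeFilt_comp_left w.2 (isFilt_Ici a) (isFilt_Ici b)
    (fun c hc d hd => w.2.up (mul_mono hc hd) h)
  obtain ⟨y, hy, hby, hxy⟩ := exists_isPrimeFilt_comp_right w.2 hx.toIsFilt (isFilt_Ici b) hxb
  exact ⟨⟨x, hx⟩, ⟨y, hy⟩, hxy, hax Set.self_mem_Ici, hby Set.self_mem_Ici⟩

/-- If `a \ b ∉ w`, then by residuation the filter generated by the products of `↑a` and `w` misses
`↓b`. It extends to a prime `z` without `b`, and squeezing `↑a` gives the point `x`. -/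
theorem lres_mem_iff {a b : DFL K V} {w : Point K V} :
    lres a b ∈ w.1 ↔ ∀ x z : Point K V, Comp z.1 x.1 w.1 → a ∈ x.1 → b ∈ z.1 := by
  refine ⟨fun h x z hc hx => z.2.up (mul_lres_self_le b a) (hc a hx _ h), fun h => ?_⟩
  by_contra hab
  obtain ⟨z, hz, hfz, hzb⟩ := exists_isPrimeFilt_of_disjoint
    ((isFilt_Ici a).filtMul w.2.toIsFilt) (isIdl_Iic b) (by
      rintro c ⟨a', ha', d, hd, hc⟩ hcb
      exact hab (w.2.up (le_lres_iff.mpr ((mul_mono ha' le_rfl).trans (hc.trans hcb))) hd))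
  obtain ⟨x, hx, hax, hxw⟩ := exists_isPrimeFilt_comp_left hz (isFilt_Ici a) w.2.toIsFilt
    (fun c hc d hd => hfz (comp_filtMul _ _ c hc d hd))
  exact hzb b (h ⟨x, hx⟩ ⟨z, hz⟩ hxw (hax Set.self_mem_Ici)) Set.self_mem_Iic

theorem rres_mem_iff {a b : DFL K V} {w : Point K V} :
    rres b a ∈ w.1 ↔ ∀ y z : Point K V, Comp z.1 w.1 y.1 → a ∈ y.1 → b ∈ z.1 := by
  refine ⟨fun h x z hc hx => z.2.up (rres_mul_self_le b a) (hc _ h a hx), fun h => ?_⟩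
  by_contra hab
  obtain ⟨z, hz, hfz, hzb⟩ := exists_isPrimeFilt_of_disjoint
    (w.2.toIsFilt.filtMul (isFilt_Ici a)) (isIdl_Iic b) (by
      rintro c ⟨d, hd, a', ha', hc⟩ hcb
      exact hab (w.2.up (le_rres_iff.mpr ((mul_mono le_rfl ha').trans (hc.trans hcb))) hd))
  obtain ⟨x, hx, hax, hxw⟩ := exists_isPrimeFilt_comp_right hz w.2.toIsFilt (isFilt_Ici a)
    (fun c hc d hd => hfz (comp_filtMul _ _ c hc d hd))
  exact hzb b (h ⟨x, hx⟩ ⟨z, hz⟩ hxw (hax Set.self_mem_Ici)) Set.self_mem_Iic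

/-- A term holds at a point of the canonical coalgebra iff its class belongs to the point. -/
theorem mem_interp_canonical (a : Fml K V) : ∀ w : Point K V,
    w ∈ (interp (canonical K V) canonicalVal a).1 ↔ mk a ∈ w.1 := by
  induction a with
  | var p => exact fun w => Iff.rfl
  | inf a b iha ihb =>
    intro w
    rw [mk_inf]
    refine (and_congr (iha w) (ihb w)).trans ⟨fun h => w.2.inf h.1 h.2, fun h => ?_⟩
    exact ⟨w.2.up inf_le_left h, w.2.up inf_le_right h⟩
  | sup a b iha ihb =>
    intro w
    rw [mk_sup]
    refine (or_congr (iha w) (ihb w)).trans ⟨fun h => ?_, w.2.prime⟩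
    exact h.elim (w.2.up le_sup_left) (w.2.up le_sup_right)
  | top h => exact fun w => iff_of_true trivial (w.2.top h)
  | bot h => exact fun w => iff_of_false id (w.2.bot h)
  | compl h a iha =>
    intro w
    have hb : K.HasBounds := by cases K <;> first | exact h.elim | trivial
    constructor
    · intro hw
      have h1 : mk a ⊔ mk (.compl h a) ∈ w.1 := by
        have h2 : mk a ⊔ mk (.compl h a) = mk (.top hb) := mk_eq_of_eqv (Eqv.sup_compl h hb a)
        rw [h2]; exact w.2.top hb
      exact (w.2.prime h1).resolve_left fun h' => hw w le_rfl ((iha w).mpr h')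
    · intro hw y hy hya
      have h3 : mk a ⊓ mk (.compl h a) ∈ y.1 := y.2.inf ((iha y).mp hya) (hy hw)
      have h4 : mk a ⊓ mk (.compl h a) = mk (.bot hb) := mk_eq_of_eqv (Eqv.inf_compl h hb a)
      rw [h4] at h3
      exact y.2.bot hb h3
  | I => exact fun w => mem_deltaI_comap
  | tens a b iha ihb =>
    intro w
    rw [mk_tens, mul_mem_iff]
    refine mem_deltaTens_comap.trans ?_
    simp only [iha, ihb]
  | lres a b iha ihb =>
    intro w
    rw [mk_lres, lres_mem_iff]
    refine mem_deltaLres_comap.trans ?_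
    simp only [iha, ihb]
  | rres b a ihb iha =>
    intro w
    rw [mk_rres, rres_mem_iff]
    refine mem_deltaRres_comap.trans ?_
    simp only [iha, ihb]

end Canonical

end RL

theorem mainTheorem1 (K : RL.Kernel) (V : Type u) (Φ Ψ : Set (RL.DFL K V))
    (hΦΨ : ¬ RL.Entails Φ Ψ) :
    ∃ (W : Type u) (_ : PartialOrder W) (γ : RL.Coalg W) (v : V → RL.Up W) (x : W),
      K.IsDomain W ∧ RL.ValidatesFC K γ ∧
      (∀ a : RL.Fml K V, RL.DFL.mk a ∈ Φ → x ∈ (RL.interp γ v a).1) ∧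
      (∀ b : RL.Fml K V, RL.DFL.mk b ∈ Ψ → x ∉ (RL.interp γ v b).1) := by
  obtain ⟨p, hp, hΦ, hΨ⟩ := RL.DFL.exists_isPrimeFilt_of_not_entails hΦΨ
  exact ⟨RL.Point K V, inferInstance, RL.canonical K V, RL.canonicalVal, ⟨p, hp⟩,
    RL.isDomain_point, RL.validatesFC_canonical,
    fun a ha => (RL.mem_interp_canonical a _).mpr (hΦ ha),
    fun b hb h => hΨ _ hb ((RL.mem_interp_canonical b _).mp h)⟩
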